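/- **Theorem 1.5.** Let $n\ge k\ge 0$ be integers, let $\mathrm{Gr}(n,k)$ be the set of $k$-dimensional linear subspaces of $\mathbb R^n$ with the metric $d(V,W)=\|\pi_V-\pi_W\|$ (operator norm), where $\pi_V:\mathbb R^n\to V$ is the orthogonal projection onto $V$. Write $\dim$ for Hausdorff dimension. In any metric space $X$, the upper box dimension is $$\overline{\dim}_B E=\sup\{t\in[0,\infty):\limsup_{\delta\downarrow0}N(E,\delta)\,\delta^t>0\},$$ where $N(E,\delta)$ is the least number of closed balls of radius $\delta$ (with centres in $X$) covering $E$, and the packing dimension is $$\dim_P E=\inf\Big\{\sup_{i}\overline{\dim}_B E_i:\ E=\bigcup_{i=1}^\infty E_i,\ E_i \text{ bounded}\Big\}.$$ The empty set has dimension $-\infty$ in all three senses. A Lipschitz map $f$ is called *almost dimension conserving* for $A\subseteq\mathbb R^n$ if there is a real number $\Delta\ge0$ such that, for every $\varepsilon>0$, $$\Delta+\dim\{y\in f(A):\dim(A\cap f^{-1}(y))\ge\Delta-\varepsilon\}\ \ge\ \dim A.$$ Let $A\subset\mathbb R^n$ be a bounded set with $\dim A=\overline{\dim}_B A$. Suppose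 that $F\subseteq\mathrm{Gr}(n,k)$ is a set such that $\pi_V$ is almost dimension conserving for $A$ for every $V\in\mathrm{Gr}(n,k)\setminus F$, and put $t:=\dim_P F$. Then, for every real $s$ with $0\le s<\dim A$, $$\dim_P\{V\in\mathrm{Gr}(n,k):\dim\pi_V(A)\le s\}\ \le\ \max\big(k(n-k)-(k-s),\,t\big).$$ -/

import Mathlib

open Filter Topology

/-- The Grassmannian of `k`-dimensional linear subspaces of `ℝⁿ`. -/
def Gr (n k : ℕ) : Type :=
  {V : Submodule ℝ (EuclideanSpace ℝ (Fin n)) // Module.finrank ℝ V = k}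

namespace Gr

/-- The orthogonal projection `π_V : ℝⁿ → V`. -/
noncomputable def proj {n k : ℕ} (V : Gr n k) : EuclideanSpace ℝ (Fin n) → V.1 :=
  fun x => V.1.orthogonalProjectionOnto x

/-- The orthogonal projection onto `V`, as a bounded operator on `ℝⁿ`. -/
noncomputable def projL {n k : ℕ} (V : Gr n k) :
    EuclideanSpace ℝ (Fin n) →L[ℝ] EuclideanSpace ℝ (Fin n) :=
  V.1.starProjection

theorem projL_injective {n k : ℕ} : Function.Injective (projL : Gr n k → _) := by
  intro V W h
  apply Subtype.ext
  exact Submodule.starProjection_inj.1 h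

/-- The metric `d(V, W) = ‖π_V - π_W‖` (operator norm) on the Grassmannian. -/
noncomputable instance instMetricSpace (n k : ℕ) : MetricSpace (Gr n k) :=
  MetricSpace.induced projL projL_injective inferInstance

theorem dist_eq {n k : ℕ} (V W : Gr n k) : dist V W = ‖projL V - projL W‖ :=
  dist_eq_norm (projL V) (projL W)

end Gr

open scoped Classical in
/-- Hausdorff dimension, with the convention `dim ∅ = -∞`. -/
noncomputable def hausdorffDim {X : Type*} [EMetricSpace X] (A : Set X) : EReal :=
  if A = ∅ then ⊥ else ((dimH A : ENNReal) : EReal)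

/-- Upper box dimension: the supremum of all `t ∈ [0, ∞)` with
`limsup_{δ ↓ 0} N(A, δ) δ ^ t > 0`, where `N(A, δ)` is the least number of closed balls of radius
`δ` (with centres anywhere in `X`) that cover `A`. It is `-∞` for the empty set. -/
noncomputable def upperBoxDim {X : Type*} [PseudoEMetricSpace X] (A : Set X) : EReal :=
  ⨆ (t : NNReal) (_ : 0 < limsup
    (fun δ : NNReal => ((Metric.externalCoveringNumber δ A : ℕ∞) : ENNReal) *
      (δ : ENNReal) ^ (t : ℝ)) (𝓝[>] 0)), ((t : ℝ) : EReal)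

/-- Packing dimension: the infimum, over all countable decompositions of `A` into bounded sets, of
the supremum of the upper box dimensions of the pieces. -/
noncomputable def packingDim {X : Type*} [PseudoMetricSpace X] (A : Set X) : EReal :=
  ⨅ (B : ℕ → Set X) (_ : A = ⋃ i, B i) (_ : ∀ i, Bornology.IsBounded (B i)),
    ⨆ i, upperBoxDim (B i)

/-- A Lipschitz map `f` is almost dimension conserving for `A` if there is a real `Δ ≥ 0` such that
`Δ + dim {y ∈ f(A) : dim (A ∩ f⁻¹(y)) ≥ Δ - ε} ≥ dim A` for every `ε > 0`
(where `dim ∅ = -∞`, so that the set of such `y` is in particular nonempty if `A` is). -/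
def AlmostDimConserving {X Y : Type*} [EMetricSpace X] [EMetricSpace Y] (f : X → Y) (A : Set X) :
    Prop :=
  (∃ K : NNReal, LipschitzWith K f) ∧
    ∃ Δ : ℝ, 0 ≤ Δ ∧ ∀ ε : ℝ, 0 < ε →
      hausdorffDim A ≤ (Δ : EReal) +
        hausdorffDim {y ∈ f '' A | ((Δ - ε : ℝ) : EReal) ≤ hausdorffDim (A ∩ f ⁻¹' {y})}

/-! ### Covering and packing numbers against box and Hausdorff dimension. -/

section Covering

open Metric Set MeasureTheory
open scoped NNReal ENNReal

/-! Put `a = dim A`. If `V ∉ F` and `dim π_V(A) ≤ s`, dimension conservation gives some `D`, at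
least about `a - s`, such that the points `y` whose fibre has dimension above `D` form a set of
dimension about `a - D` or more (`AlmostDimConserving.exists_rat_lt`). Since `D ≥ 0`, such a fibre
has dimension above `D` near each of two distinct points, so it is rich inside two separated basic
open sets. Countably many choices of `D`, basic sets and scales suffice to describe all these `V`
(`Gr.exists_mem_manyRichFibers`), so it is enough to bound the upper box dimension of one class
`manyRichFibers`.

That bound is a double count (`Gr.upperBoxDim_manyRichFibers_le`). Since the box dimension of `A` is
also `a`, about `δ^(-a)` balls of radius `δ` cover `A`. Each `V` of the class makes about `δ^(-(a -
D) - 2D)` pairs of centres far apart but with nearly equal projections (`Gr.mul_le_card_pairs`).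
Conversely, a difference `z` of far apart centres is nearly killed by at most about `δ^(-(k(n-k) -
k))` of the `V` in a `δ`-separated family, because `π_V z = 0` imposes `k` independent conditions on
`V` (`Gr.card_le_of_dist_le`). Dividing, the class has box dimension at most `k(n-k) - k + a - D`,
hence about `k(n-k) - (k - s)`. -/

theorem exists_isSeparated_isCover_of_card_le {X : Type*} [PseudoEMetricSpace X] {Y : Set X}
    {r : ℝ≥0} (b : ℕ)
    (h : ∀ S : Finset X, (S : Set X) ⊆ Y → IsSeparated r (S : Set X) → S.card ≤ b) :
    ∃ S : Finset X, (S : Set X) ⊆ Y ∧ IsSeparated r (S : Set X) ∧ IsCover r Y (S : Set X) := by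
  classical
  let Q : ℕ → Prop := fun m =>
    ∃ S : Finset X, (S : Set X) ⊆ Y ∧ IsSeparated r (S : Set X) ∧ S.card = m
  have hQ0 : Q 0 := ⟨∅, by simp, by simp, rfl⟩
  -- A separated subset of largest cardinality is a net: an uncovered point could be added to it.
  obtain ⟨S, hSY, hS, hcard⟩ := Nat.findGreatest_spec (P := Q) (Nat.zero_le b) hQ0
  refine ⟨S, hSY, hS, fun x hx => ?_⟩
  by_contra! hx'
  have hxS : x ∉ S := fun hxS => hx' x hxS (by simp)
  have hsep : IsSeparated r ((insert x S : Finset X) : Set X) := by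
    rw [Finset.coe_insert]
    refine hS.insert fun y hy _ => ?_
    have := hx' y hy
    simpa using this
  have hsub : ((insert x S : Finset X) : Set X) ⊆ Y := by
    rw [Finset.coe_insert]; exact insert_subset hx hSY
  have hle := Nat.le_findGreatest (P := Q) (h _ hsub hsep) ⟨_, hsub, hsep, rfl⟩
  rw [Finset.card_insert_of_notMem hxS, hcard] at hle
  omega

theorem exists_isCover_card_le {X : Type*} [PseudoEMetricSpace X] {Y : Set X}
    {r : ℝ≥0} {b : ℝ}
    (h : ∀ S : Finset X, (S : Set X) ⊆ Y → IsSeparated r (S : Set X) → (S.card : ℝ) ≤ b) :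
    ∃ S : Finset X, IsCover r Y (S : Set X) ∧ (S.card : ℝ) ≤ b := by
  obtain ⟨S, h1, h2, h3⟩ := exists_isSeparated_isCover_of_card_le (Y := Y) (r := r) ⌊b⌋₊
    fun S h1 h2 => Nat.le_floor (h S h1 h2)
  exact ⟨S, h3, h S h1 h2⟩

theorem exists_isSeparated_le_card {X : Type*} [PseudoEMetricSpace X] {Y : Set X}
    {r : ℝ≥0} {b : ℝ} (h : ∀ N : Finset X, IsCover r Y (N : Set X) → b ≤ N.card) :
    ∃ S : Finset X, (S : Set X) ⊆ Y ∧ IsSeparated r (S : Set X) ∧ b ≤ S.card := by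
  by_contra! H
  obtain ⟨S, h1, h2, h3⟩ := exists_isSeparated_isCover_of_card_le (Y := Y) (r := r) ⌈b⌉₊
    fun S h1 h2 => by exact_mod_cast (H S h1 h2).le.trans (Nat.le_ceil b)
  exact (H S h1 h2).not_ge (h S h3)

theorem ENNReal_coe_rpow_eq_ofReal {δ : ℝ≥0} (hδ : 0 < δ) (t : ℝ) :
    (δ : ℝ≥0∞) ^ t = ENNReal.ofReal ((δ : ℝ) ^ t) := by
  rw [← ENNReal.ofReal_rpow_of_pos (by exact_mod_cast hδ), ENNReal.ofReal_coe_nnreal]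

theorem tendsto_coe_nhdsGT_zero :
    Tendsto (fun δ : ℝ≥0 => (δ : ℝ)) (𝓝[>] 0) (𝓝[>] 0) := by
  refine tendsto_nhdsWithin_iff.2 ⟨?_, ?_⟩
  · exact (NNReal.continuous_coe.tendsto' 0 0 rfl).mono_left nhdsWithin_le_nhds
  · filter_upwards [self_mem_nhdsWithin] with δ hδ
    exact_mod_cast hδ

theorem upperBoxDim_le_of_isCover {X : Type*} [PseudoEMetricSpace X] {E : Set X} {u C : ℝ}
    (h : ∀ᶠ δ : ℝ≥0 in 𝓝[>] 0, ∃ N : Finset X, IsCover δ E (N : Set X) ∧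
      (N.card : ℝ) ≤ C * (δ : ℝ) ^ (-u)) : upperBoxDim E ≤ (u : EReal) := by
  refine iSup₂_le fun t ht => ?_
  rw [EReal.coe_le_coe_iff]
  by_contra! hut
  refine ht.ne' (Tendsto.limsup_eq ?_)
  have hlim : Tendsto (fun δ : ℝ≥0 => ENNReal.ofReal (C * (δ : ℝ) ^ ((t : ℝ) - u)))
      (𝓝[>] 0) (𝓝 0) := by
    rw [← ENNReal.ofReal_zero]
    refine ENNReal.tendsto_ofReal ?_
    have h1 : Tendsto (fun x : ℝ => x ^ ((t : ℝ) - u)) (𝓝[>] 0) (𝓝 0) := by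
      have := (Real.continuousAt_rpow_const 0 ((t : ℝ) - u) (Or.inr (by linarith))).tendsto
      rw [Real.zero_rpow (by linarith)] at this
      exact this.mono_left nhdsWithin_le_nhds
    simpa using (h1.comp tendsto_coe_nhdsGT_zero).const_mul C
  refine tendsto_of_tendsto_of_tendsto_of_le_of_le' tendsto_const_nhds hlim
    (Eventually.of_forall fun _ => zero_le) ?_
  filter_upwards [h, self_mem_nhdsWithin] with δ ⟨N, hN, hcard⟩ hδ
  have hδ' : (0 : ℝ) < δ := by exact_mod_cast hδ
  have h1 : ((externalCoveringNumber δ E : ℕ∞) : ℝ≥0∞) ≤ ENNReal.ofReal (C * (δ : ℝ) ^ (-u)) := by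
    have := hN.externalCoveringNumber_le_encard
    rw [Set.encard_coe_eq_coe_finsetCard] at this
    calc ((externalCoveringNumber δ E : ℕ∞) : ℝ≥0∞) ≤ ((N.card : ℕ∞) : ℝ≥0∞) := by
          exact_mod_cast this
      _ = ENNReal.ofReal (N.card : ℝ) := by simp
      _ ≤ _ := ENNReal.ofReal_le_ofReal hcard
  calc _ ≤ ENNReal.ofReal (C * (δ : ℝ) ^ (-u)) * ENNReal.ofReal ((δ : ℝ) ^ (t : ℝ)) := by
        rw [ENNReal_coe_rpow_eq_ofReal hδ]; gcongr
    _ = _ := by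
        rw [← ENNReal.ofReal_mul' (by positivity), mul_assoc, ← Real.rpow_add hδ']
        congr 3; ring

theorem eventually_exists_isCover_of_upperBoxDim_lt {X : Type*} [PseudoEMetricSpace X] {E : Set X}
    {u : ℝ} (hu : 0 ≤ u) (h : upperBoxDim E < (u : EReal)) :
    ∀ᶠ δ : ℝ≥0 in 𝓝[>] 0, ∃ N : Finset X, IsCover δ E (N : Set X) ∧
      (N.card : ℝ) ≤ (δ : ℝ) ^ (-u) := by
  lift u to ℝ≥0 using hu
  have hlim : limsup (fun δ : ℝ≥0 => ((externalCoveringNumber δ E : ℕ∞) : ℝ≥0∞) *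
      (δ : ℝ≥0∞) ^ (u : ℝ)) (𝓝[>] 0) ≤ 0 := by
    by_contra! hpos
    exact h.not_ge (le_iSup₂_of_le (f := fun (t : ℝ≥0) _ => ((t : ℝ) : EReal)) u hpos le_rfl)
  have hlt := eventually_lt_of_limsup_lt (hlim.trans_lt one_pos)
  filter_upwards [hlt, self_mem_nhdsWithin] with δ hδ1 hδ
  have hδ' : (0 : ℝ) < δ := by exact_mod_cast hδ
  have hδ0 : (δ : ℝ≥0∞) ^ (u : ℝ) ≠ 0 := by
    rw [ENNReal_coe_rpow_eq_ofReal hδ]; simp; positivity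
  have hne : externalCoveringNumber δ E ≠ ⊤ := by
    intro htop
    rw [htop] at hδ1
    simp [ENNReal.top_mul hδ0] at hδ1
  obtain ⟨m, hm⟩ := ENat.ne_top_iff_exists.1 hne
  have hlt' : externalCoveringNumber δ E < ((m + 1 : ℕ) : ℕ∞) := by
    rw [← hm]; exact_mod_cast Nat.lt_succ_self m
  rw [externalCoveringNumber] at hlt'
  simp only [iInf_lt_iff] at hlt'
  obtain ⟨N, hN, hNc⟩ := hlt'
  have hfin : N.Finite := Set.finite_of_encard_le_coe hNc.le
  refine ⟨hfin.toFinset, by simpa using hN, ?_⟩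
  have hcm : hfin.toFinset.card ≤ m := by
    rw [hfin.encard_eq_coe_toFinset_card] at hNc
    have : hfin.toFinset.card < m + 1 := by exact_mod_cast hNc
    omega
  have hm1 : (m : ℝ) * (δ : ℝ) ^ (u : ℝ) < 1 := by
    rw [← hm, ENNReal_coe_rpow_eq_ofReal hδ] at hδ1
    have : ENNReal.ofReal ((m : ℝ) * (δ : ℝ) ^ (u : ℝ)) < 1 := by
      rw [ENNReal.ofReal_mul (by positivity)]
      simpa using hδ1
    rwa [ENNReal.ofReal_lt_one] at this
  calc (hfin.toFinset.card : ℝ) ≤ m := by exact_mod_cast hcm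
    _ ≤ 1 / (δ : ℝ) ^ (u : ℝ) := by rw [le_div_iff₀ (by positivity)]; exact hm1.le
    _ = _ := by rw [Real.rpow_neg hδ'.le, one_div]

/-- Otherwise fewer than `r^(-d)` balls suffice along a sequence of radii `r → 0`; their diameters
are at most `2r`, so the `d`-dimensional Hausdorff measure is at most `2^d` and the dimension at
most `d`. -/
theorem eventually_le_card_of_lt_dimH {X : Type*} [EMetricSpace X] {G : Set X} {d : ℝ≥0}
    (h : (d : ℝ≥0∞) < dimH G) :
    ∀ᶠ δ : ℝ≥0 in 𝓝[>] 0, ∀ N : Finset X, IsCover δ G (N : Set X) →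
      (δ : ℝ) ^ (-(d : ℝ)) ≤ N.card := by
  borelize X
  by_contra hcon
  rw [not_eventually] at hcon
  have hfreq := hcon.and_eventually (self_mem_nhdsWithin)
  obtain ⟨r, hr, hr'⟩ := exists_seq_forall_of_frequently hfreq
  have hr0 : Tendsto r atTop (𝓝 0) := hr.mono_right nhdsWithin_le_nhds
  push Not at hr'
  choose hN hpos using hr'
  choose N hcov hcard using hN
  have hmeas : Measure.hausdorffMeasure (d : ℝ) G ≠ ⊤ := by
    have hle := Measure.hausdorffMeasure_le_liminf_sum (ι := fun m => N m) (d : ℝ) G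
      (l := atTop) (fun m => 2 * (r m : ℝ≥0∞))
      (by
        have : Tendsto (fun m => (r m : ℝ≥0∞)) atTop (𝓝 0) :=
          ENNReal.tendsto_coe.2 hr0
        simpa using ENNReal.Tendsto.const_mul this (Or.inr (by simp)))
      (fun m x => closedEBall (x : X) (r m))
      (Eventually.of_forall fun m x => ediam_closedEBall_le)
      (Eventually.of_forall fun m x hx => by
        obtain ⟨y, hy, hxy⟩ := hcov m hx
        exact mem_iUnion.2 ⟨⟨y, hy⟩, hxy⟩)
    refine ne_top_of_le_ne_top (b := ENNReal.ofReal ((2 : ℝ) ^ (d : ℝ))) (by simp) (hle.trans ?_)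
    refine liminf_le_of_le (by isBoundedDefault) fun b hb => ?_
    obtain ⟨m, hm⟩ := hb.exists
    refine hm.trans ?_
    have hrm : (0 : ℝ) < r m := by exact_mod_cast hpos m
    calc ∑ x : N m, ediam (closedEBall (x : X) (r m)) ^ (d : ℝ)
        ≤ ∑ x : N m, ENNReal.ofReal ((2 * r m : ℝ) ^ (d : ℝ)) := by
          refine Finset.sum_le_sum fun x _ => ?_
          rw [← ENNReal.ofReal_rpow_of_pos (by positivity)]
          refine ENNReal.rpow_le_rpow (ediam_closedEBall_le.trans (le_of_eq ?_)) d.2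
          rw [ENNReal.ofReal_mul (by norm_num)]; simp
      _ = ENNReal.ofReal ((N m).card * (2 * r m : ℝ) ^ (d : ℝ)) := by
          rw [ENNReal.ofReal_mul (by positivity)]; simp
      _ ≤ _ := by
          refine ENNReal.ofReal_le_ofReal ?_
          calc ((N m).card : ℝ) * (2 * r m : ℝ) ^ (d : ℝ)
              ≤ (r m : ℝ) ^ (-(d : ℝ)) * (2 * r m : ℝ) ^ (d : ℝ) := by
                gcongr; exact (hcard m).le
            _ = _ := by
                rw [Real.mul_rpow (by norm_num) hrm.le, Real.rpow_neg hrm.le]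
                field_simp
  exact h.not_ge (dimH_le_of_hausdorffMeasure_ne_top hmeas)

theorem hausdorffDim_of_nonempty {X : Type*} [EMetricSpace X] {G : Set X} (hG : G.Nonempty) :
    hausdorffDim G = ((dimH G : ℝ≥0∞) : EReal) := if_neg hG.ne_empty

theorem nonempty_of_lt_hausdorffDim {X : Type*} [EMetricSpace X] {G : Set X} {x : EReal}
    (h : x < hausdorffDim G) : G.Nonempty := by
  rw [nonempty_iff_ne_empty]
  rintro rfl
  simp [hausdorffDim] at h

theorem eventually_le_card_of_lt_hausdorffDim {X : Type*} [EMetricSpace X] {G : Set X} {d : ℝ}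
    (h : (d : EReal) < hausdorffDim G) :
    ∀ᶠ δ : ℝ≥0 in 𝓝[>] 0, ∀ N : Finset X, IsCover δ G (N : Set X) →
      (δ : ℝ) ^ (-d) ≤ N.card := by
  have hne := nonempty_of_lt_hausdorffDim h
  rcases le_or_gt 0 d with hd | hd
  · lift d to ℝ≥0 using hd
    refine eventually_le_card_of_lt_dimH ?_
    rwa [hausdorffDim_of_nonempty hne, ← EReal.coe_nnreal_eq_coe_real,
      EReal.coe_ennreal_lt_coe_ennreal_iff] at h
  -- For negative `d` the hypothesis only says that `G` is nonempty, which is enough: one ball is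
  -- needed.
  · have h1 : ∀ᶠ δ : ℝ≥0 in 𝓝[>] 0, δ ≤ 1 :=
      nhdsWithin_le_nhds (eventually_le_nhds one_pos)
    filter_upwards [h1] with δ hδ N hN
    have hN1 : 1 ≤ N.card := Finset.card_pos.2 (by exact_mod_cast hN.nonempty hne)
    calc (δ : ℝ) ^ (-d) ≤ 1 :=
          Real.rpow_le_one δ.2 (by exact_mod_cast hδ) (by linarith)
      _ ≤ N.card := by exact_mod_cast hN1

end Covering

/-! ### Distance between subspaces, read off from lifts of a basis of a nearby subspace. -/

namespace Gr

open Metric Set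
open scoped NNReal ENNReal RealInnerProductSpace

variable {n k : ℕ}

theorem norm_projL_apply_le (V : Gr n k) (x : EuclideanSpace ℝ (Fin n)) : ‖projL V x‖ ≤ ‖x‖ :=
  Submodule.norm_starProjection_apply_le V.1 x

theorem projL_mem (V : Gr n k) (x : EuclideanSpace ℝ (Fin n)) : projL V x ∈ V.1 :=
  Submodule.starProjection_apply_mem V.1 x

theorem projL_eq_self {V : Gr n k} {x : EuclideanSpace ℝ (Fin n)} (hx : x ∈ V.1) :
    projL V x = x := Submodule.starProjection_eq_self_iff.2 hx

theorem inner_projL_left (V : Gr n k) (x y : EuclideanSpace ℝ (Fin n)) :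
    ⟪projL V x, y⟫ = ⟪x, projL V y⟫ := Submodule.inner_starProjection_left_eq_right V.1 x y

theorem norm_projL_sub_le (V W : Gr n k) (x : EuclideanSpace ℝ (Fin n)) :
    ‖projL V x - projL W x‖ ≤ dist V W * ‖x‖ := by
  rw [dist_eq]; exact (projL V - projL W).le_opNorm x

theorem norm_le_two_mul_of_dist_le {V V₀ : Gr n k} (h : dist V V₀ ≤ 1 / 4)
    {x : EuclideanSpace ℝ (Fin n)} (hx : x ∈ V.1) : ‖x‖ ≤ 2 * ‖projL V₀ x‖ := by
  have h1 := norm_projL_sub_le V V₀ x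
  rw [projL_eq_self hx] at h1
  have h2 := norm_sub_norm_le x (projL V₀ x)
  nlinarith [norm_nonneg x]

theorem exists_mem_projL_eq {V V₀ : Gr n k} (h : dist V V₀ ≤ 1 / 4)
    {b : EuclideanSpace ℝ (Fin n)} (hb : b ∈ V₀.1) :
    ∃ v ∈ V.1, projL V₀ v = b ∧ ‖v‖ ≤ 2 * ‖b‖ := by
  let L : V.1 →ₗ[ℝ] V₀.1 :=
    ((projL V₀).toLinearMap.domRestrict V.1).codRestrict V₀.1 fun x => projL_mem V₀ x
  have hL : Function.Injective L := by
    refine (injective_iff_map_eq_zero L).2 fun x hx => ?_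
    have h1 : projL V₀ x = 0 := congrArg Subtype.val hx
    have h2 := norm_le_two_mul_of_dist_le h x.2
    rw [h1] at h2
    exact Subtype.ext (by simpa using h2)
  have hs := (LinearMap.injective_iff_surjective_of_finrank_eq_finrank
    (V.2.trans V₀.2.symm)).1 hL
  obtain ⟨v, hv⟩ := hs ⟨b, hb⟩
  have hv' : projL V₀ v = b := congrArg Subtype.val hv
  exact ⟨v, v.2, hv', hv' ▸ norm_le_two_mul_of_dist_le h v.2⟩

/-- Split `π_V - π_W = (1 - π_W) π_V - π_W (1 - π_V)`; the second term is the adjoint of `(1 - π_V)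
π_W`. -/
theorem dist_le_of_norm_sub_projL_le {V W : Gr n k} {θ : ℝ}
    (hVW : ∀ x ∈ V.1, ‖x - projL W x‖ ≤ θ * ‖x‖) (hWV : ∀ x ∈ W.1, ‖x - projL V x‖ ≤ θ * ‖x‖)
    (hθ : 0 ≤ θ) : dist V W ≤ 2 * θ := by
  rw [dist_eq]
  refine ContinuousLinearMap.opNorm_le_bound _ (by positivity) fun x => ?_
  have h1 : ‖projL V x - projL W (projL V x)‖ ≤ θ * ‖x‖ :=
    (hVW _ (projL_mem V x)).trans (by gcongr; exact norm_projL_apply_le V x)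
  have h2 : ‖projL W (x - projL V x)‖ ≤ θ * ‖x‖ := by
    set y := projL W (x - projL V x) with hy
    have hyW : y ∈ W.1 := projL_mem W _
    have h3 : ‖y‖ * ‖y‖ ≤ (θ * ‖x‖) * ‖y‖ := by
      calc ‖y‖ * ‖y‖ = ⟪y, y⟫ := (real_inner_self_eq_norm_mul_norm y).symm
        _ = ⟪y, x - projL V x⟫ := by
            conv_lhs => rw [hy, ← hy, inner_projL_left, projL_eq_self hyW]
            exact real_inner_comm _ _
        _ = ⟪y - projL V y, x⟫ := by
            rw [inner_sub_right, inner_sub_left, inner_projL_left V]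
        _ ≤ ‖y - projL V y‖ * ‖x‖ := real_inner_le_norm _ _
        _ ≤ (θ * ‖y‖) * ‖x‖ := by gcongr; exact hWV y hyW
        _ = _ := by ring
    rcases (norm_nonneg y).eq_or_lt with h0 | h0
    · rw [← h0]; positivity
    · exact le_of_mul_le_mul_right h3 h0
  calc ‖(projL V - projL W) x‖
      = ‖(projL V x - projL W (projL V x)) - projL W (x - projL V x)‖ := by
        congr 1; simp
    _ ≤ θ * ‖x‖ + θ * ‖x‖ := (norm_sub_le _ _).trans (add_le_add h1 h2)
    _ = _ := by ring

theorem norm_sub_projL_le_of_basis {V W V₀ : Gr n k} (h : dist V V₀ ≤ 1 / 4)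
    (b : OrthonormalBasis (Fin k) ℝ V₀.1) {v w : Fin k → EuclideanSpace ℝ (Fin n)}
    (hv : ∀ j, v j ∈ V.1) (hw : ∀ j, w j ∈ W.1) (hvb : ∀ j, projL V₀ (v j) = b j) {θ : ℝ}
    (hvw : ∀ j, ‖v j - w j‖ ≤ θ) {x : EuclideanSpace ℝ (Fin n)} (hx : x ∈ V.1) :
    ‖x - projL W x‖ ≤ k * θ * ‖x‖ := by
  set a : Fin k → ℝ := fun j => ⟪(b j : EuclideanSpace ℝ (Fin n)), x⟫ with ha
  have hP : projL V₀ x = ∑ j, a j • (b j : EuclideanSpace ℝ (Fin n)) := by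
    have h1 := congrArg Subtype.val (b.sum_repr' ⟨projL V₀ x, projL_mem V₀ x⟩)
    simp only [Submodule.coe_inner, AddSubmonoidClass.coe_finsetSum, Submodule.coe_smul] at h1
    rw [← h1]
    refine Finset.sum_congr rfl fun j _ => ?_
    rw [← inner_projL_left, projL_eq_self (b j).2]
  -- `π_{V₀}` is injective on `V`, and both sides have the same image under it.
  have hxsum : x = ∑ j, a j • v j := by
    have hmem : x - ∑ j, a j • v j ∈ V.1 :=
      V.1.sub_mem hx (V.1.sum_mem fun j _ => V.1.smul_mem _ (hv j))
    have h1 := norm_le_two_mul_of_dist_le h hmem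
    rw [map_sub, map_sum, hP] at h1
    simp only [map_smul, hvb, sub_self, norm_zero, mul_zero] at h1
    exact sub_eq_zero.1 (norm_le_zero_iff.1 h1)
  have hmin : ‖x - projL W x‖ ≤ ‖x - ∑ j, a j • w j‖ := by
    have hmem : ∑ j, a j • w j ∈ W.1 := W.1.sum_mem fun j _ => W.1.smul_mem _ (hw j)
    have := Submodule.starProjection_minimal (U := W.1) x
    rw [show projL W x = W.1.starProjection x from rfl, this]
    exact ciInf_le (f := fun y : W.1 => ‖x - y‖) ⟨0, by rintro _ ⟨y, rfl⟩; positivity⟩ ⟨_, hmem⟩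
  refine hmin.trans ?_
  calc ‖x - ∑ j, a j • w j‖ = ‖∑ j, a j • (v j - w j)‖ := by
        conv_lhs => rw [hxsum]
        simp [smul_sub]
    _ ≤ ∑ j, ‖a j • (v j - w j)‖ := norm_sum_le _ _
    _ ≤ ∑ _j : Fin k, ‖x‖ * θ := by
        refine Finset.sum_le_sum fun j _ => ?_
        rw [norm_smul]
        have h1 : ‖a j‖ ≤ ‖x‖ := by
          have := norm_inner_le_norm (𝕜 := ℝ) (b j : EuclideanSpace ℝ (Fin n)) x
          rwa [Submodule.norm_coe, b.norm_eq_one, one_mul] at this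
        exact mul_le_mul h1 (hvw j) (norm_nonneg _) (norm_nonneg _)
    _ = _ := by simp; ring

theorem norm_le_sum_abs_inner {V₀ : Submodule ℝ (EuclideanSpace ℝ (Fin n))} {ι : Type*} [Fintype ι]
    (c : OrthonormalBasis ι ℝ V₀) {x : EuclideanSpace ℝ (Fin n)} (hx : x ∈ V₀) :
    ‖x‖ ≤ ∑ i, |⟪(c i : EuclideanSpace ℝ (Fin n)), x⟫| := by
  have h1 := congrArg Subtype.val (c.sum_repr' ⟨x, hx⟩)
  simp only [Submodule.coe_inner, AddSubmonoidClass.coe_finsetSum, Submodule.coe_smul] at h1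
  conv_lhs => rw [← h1]
  refine (norm_sum_le _ _).trans (Finset.sum_le_sum fun i _ => ?_)
  rw [norm_smul, Submodule.norm_coe, c.norm_eq_one, mul_one, Real.norm_eq_abs]

/-- As `e` has a substantial `i₀`-coordinate, near orthogonality to `e` controls the `i₀`-coordinate
of `x` by the others: one coordinate is redundant. -/
theorem norm_le_of_abs_inner_le {V₀ : Submodule ℝ (EuclideanSpace ℝ (Fin n))} {m : ℕ}
    (c : OrthonormalBasis (Fin m) ℝ V₀) {x e : EuclideanSpace ℝ (Fin n)} (hx : x ∈ V₀)
    (he : ‖e‖ = 1) {i₀ : Fin m} (hi₀ : 1 / 2 ≤ m * |⟪(c i₀ : EuclideanSpace ℝ (Fin n)), e⟫|)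
    {η : ℝ} (hη : 0 ≤ η) (hxe : |⟪x, e⟫| ≤ 4 * η)
    (hi : ∀ i, i ≠ i₀ → |⟪(c i : EuclideanSpace ℝ (Fin n)), x⟫| ≤ η) :
    ‖x‖ ≤ (m + 2 * m * (4 + m)) * η := by
  classical
  have hm : (0 : ℝ) ≤ m := Nat.cast_nonneg m
  have hrest : ∑ i ∈ Finset.univ.erase i₀, |⟪(c i : EuclideanSpace ℝ (Fin n)), x⟫| ≤ m * η := by
    calc _ ≤ ∑ i ∈ Finset.univ.erase i₀, η :=
          Finset.sum_le_sum fun i hmem => hi i (Finset.ne_of_mem_erase hmem)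
      _ = ((Finset.univ.erase i₀).card : ℝ) * η := by simp
      _ ≤ m * η := by
          gcongr
          exact (Finset.card_le_univ _).trans (by simp)
  have hsum : ⟪x, e⟫ = ∑ i, ⟪(c i : EuclideanSpace ℝ (Fin n)), x⟫ *
      ⟪(c i : EuclideanSpace ℝ (Fin n)), e⟫ := by
    have h1 := congrArg Subtype.val (c.sum_repr' ⟨x, hx⟩)
    simp only [Submodule.coe_inner, AddSubmonoidClass.coe_finsetSum, Submodule.coe_smul] at h1
    conv_lhs => rw [← h1]
    rw [sum_inner]
    simp only [real_inner_smul_left]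
  have hce : ∀ i, |⟪(c i : EuclideanSpace ℝ (Fin n)), e⟫| ≤ 1 := fun i => by
    have := abs_real_inner_le_norm (c i : EuclideanSpace ℝ (Fin n)) e
    rwa [Submodule.norm_coe, c.norm_eq_one, one_mul, he] at this
  have hmain : |⟪(c i₀ : EuclideanSpace ℝ (Fin n)), x⟫| *
      |⟪(c i₀ : EuclideanSpace ℝ (Fin n)), e⟫| ≤ (4 + m) * η := by
    rw [← Finset.add_sum_erase _ _ (Finset.mem_univ i₀)] at hsum
    have h2 : |∑ i ∈ Finset.univ.erase i₀, ⟪(c i : EuclideanSpace ℝ (Fin n)), x⟫ *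
      ⟪(c i : EuclideanSpace ℝ (Fin n)), e⟫| ≤ m * η := by
      refine ((Finset.abs_sum_le_sum_abs _ _).trans (Finset.sum_le_sum fun i _ => ?_)).trans hrest
      rw [abs_mul]
      exact mul_le_of_le_one_right (abs_nonneg _) (hce i)
    rw [← abs_mul]
    have h3 := abs_sub_abs_le_abs_sub (⟪(c i₀ : EuclideanSpace ℝ (Fin n)), x⟫ *
      ⟪(c i₀ : EuclideanSpace ℝ (Fin n)), e⟫) ⟪x, e⟫
    rw [hsum, sub_add_cancel_left, abs_neg, ← hsum] at h3
    linarith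
  have hx0 : |⟪(c i₀ : EuclideanSpace ℝ (Fin n)), x⟫| ≤ 2 * m * (4 + m) * η := by
    have h4 := mul_le_mul_of_nonneg_left hi₀ (abs_nonneg ⟪(c i₀ : EuclideanSpace ℝ (Fin n)), x⟫)
    have h5 := mul_le_mul_of_nonneg_left hmain hm
    nlinarith
  have := norm_le_sum_abs_inner c hx
  rw [← Finset.add_sum_erase _ _ (Finset.mem_univ i₀)] at this
  linarith

end Gr

/-! ### Counting separated subspaces nearly orthogonal to a unit vector. -/

namespace Gr

open Metric Set
open scoped NNReal ENNReal RealInnerProductSpace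

variable {n k : ℕ}

theorem finrank_orthogonal (V : Gr n k) : Module.finrank ℝ V.1ᗮ = n - k := by
  have h := V.1.finrank_add_finrank_orthogonal
  rw [finrank_euclideanSpace_fin, V.2] at h
  omega

theorem exists_half_le_mul_abs_inner {V₀ : Gr n k} {m : ℕ}
    (c : OrthonormalBasis (Fin m) ℝ V₀.1ᗮ) {e : EuclideanSpace ℝ (Fin n)}
    (he : ‖e‖ = 1) (heV : ‖projL V₀ e‖ ≤ 1 / 2) :
    ∃ i₀ : Fin m, 1 / 2 ≤ m * |⟪(c i₀ : EuclideanSpace ℝ (Fin n)), e⟫| := by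
  by_contra! H
  have hmem : e - projL V₀ e ∈ V₀.1ᗮ := Submodule.sub_starProjection_mem_orthogonal e
  have hnorm : 1 / 2 ≤ ‖e - projL V₀ e‖ := by
    have := norm_sub_norm_le e (projL V₀ e)
    linarith
  have hsum := norm_le_sum_abs_inner c hmem
  have hin : ∀ i, ⟪(c i : EuclideanSpace ℝ (Fin n)), e - projL V₀ e⟫
      = ⟪(c i : EuclideanSpace ℝ (Fin n)), e⟫ := fun i => by
    rw [inner_sub_right, Submodule.inner_left_of_mem_orthogonal (projL_mem V₀ e) (c i).2, sub_zero]
  simp only [hin] at hsum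
  rcases Nat.eq_zero_or_pos m with rfl | hm
  · simp at hsum
    norm_num [hsum] at hnorm
  · have hm' : (0 : ℝ) < m := by exact_mod_cast hm
    have : (m : ℝ) * ∑ i, |⟪(c i : EuclideanSpace ℝ (Fin n)), e⟫| < m * (1 / 2) := by
      rw [Finset.mul_sum]
      calc _ < ∑ _i : Fin m, (1 / 2 : ℝ) :=
            Finset.sum_lt_sum_of_nonempty ⟨⟨0, hm⟩, Finset.mem_univ _⟩ fun i _ => H i
        _ = _ := by simp
    have := lt_of_mul_lt_mul_left this hm'.le
    linarith

/-- The separation constant in the count of subspaces nearly orthogonal to a given vector. -/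
noncomputable def sepConst (n k : ℕ) : ℝ :=
  2 * (k * ((n - k : ℕ) + 2 * (n - k : ℕ) * (4 + (n - k : ℕ))))

/-- Near `V₀`, a subspace `V` is a graph over `V₀`, described by the coordinates in `V₀ᗮ` of the
lifts `v V j` of a basis of `V₀`. Near orthogonality to `e` makes the `i₀`-coordinate of each lift
redundant. Rounding the remaining `(n - k - 1) k` coordinates to multiples of `η` is then injective
on a separated family. -/
theorem card_le_of_dist_le (V₀ : Gr n k) {η : ℝ} (hη : 0 < η) (hη' : η ≤ 1 / 4)
    {e : EuclideanSpace ℝ (Fin n)} (he : ‖e‖ = 1) (𝒱 : Finset (Gr n k))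
    (hloc : ∀ V ∈ 𝒱, dist V V₀ ≤ 1 / 4) (hperp : ∀ V ∈ 𝒱, ‖projL V e‖ ≤ η)
    (hsep : ∀ V ∈ 𝒱, ∀ W ∈ 𝒱, V ≠ W → sepConst n k * η < dist V W) :
    (𝒱.card : ℝ) ≤ 6 ^ (n * k) * η ^ (-((k : ℝ) * ((n : ℝ) - k) - k)) := by
  classical
  rcases 𝒱.eq_empty_or_nonempty with rfl | ⟨V₁, hV₁⟩
  · simp; positivity
  set m := n - k with hm
  let b : OrthonormalBasis (Fin k) ℝ V₀.1 :=
    (stdOrthonormalBasis ℝ V₀.1).reindex (finCongr V₀.2)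
  let c : OrthonormalBasis (Fin m) ℝ V₀.1ᗮ :=
    (stdOrthonormalBasis ℝ V₀.1ᗮ).reindex (finCongr (finrank_orthogonal V₀))
  have heV₀ : ‖projL V₀ e‖ ≤ 1 / 2 := by
    have h1 := norm_projL_sub_le V₁ V₀ e
    have h2 := norm_sub_norm_le (projL V₀ e) (projL V₁ e)
    rw [norm_sub_rev] at h2
    have h3 := hperp V₁ hV₁
    have h4 := hloc V₁ hV₁
    rw [he, mul_one] at h1
    linarith
  obtain ⟨i₀, hi₀⟩ := exists_half_le_mul_abs_inner c he heV₀
  have hbnorm : ∀ j, ‖(b j : EuclideanSpace ℝ (Fin n))‖ = 1 := fun j => by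
    rw [Submodule.norm_coe, b.norm_eq_one]
  have hex : ∀ V : Gr n k, ∀ j, ∃ v : EuclideanSpace ℝ (Fin n), V ∈ 𝒱 →
      v ∈ V.1 ∧ projL V₀ v = b j ∧ ‖v‖ ≤ 2 := fun V j => by
    by_cases hV : V ∈ 𝒱
    · obtain ⟨v, h1, h2, h3⟩ := exists_mem_projL_eq (hloc V hV) (b j).2
      exact ⟨v, fun _ => ⟨h1, h2, by rwa [hbnorm, mul_one] at h3⟩⟩
    · exact ⟨0, fun h => absurd h hV⟩
  choose v hv using hex
  let Φ : Gr n k → ({i : Fin m // i ≠ i₀} × Fin k) → ℤ := fun V p =>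
    ⌊⟪(c p.1.1 : EuclideanSpace ℝ (Fin n)), v V p.2⟫ / η⌋
  have hinj : Set.InjOn Φ 𝒱 := by
    intro V hV W hW hVW
    by_contra hne
    have hclose : ∀ j, ‖v V j - v W j‖ ≤ (m + 2 * m * (4 + m)) * η := fun j => by
      have hmem : v V j - v W j ∈ V₀.1ᗮ := by
        rw [← Submodule.ker_starProjection]
        change projL V₀ (v V j - v W j) = 0
        rw [map_sub, (hv V j hV).2.1, (hv W j hW).2.1, sub_self]
      have hsmall : ∀ U ∈ 𝒱, |⟪v U j, e⟫| ≤ 2 * η := fun U hU => by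
        calc |⟪v U j, e⟫| = |⟪v U j, projL U e⟫| := by
              rw [← inner_projL_left, projL_eq_self (hv U j hU).1]
          _ ≤ ‖v U j‖ * ‖projL U e‖ := abs_real_inner_le_norm _ _
          _ ≤ 2 * η := mul_le_mul (hv U j hU).2.2 (hperp U hU) (norm_nonneg _) (by norm_num)
      refine norm_le_of_abs_inner_le c hmem he hi₀ hη.le ?_ fun i hi => ?_
      · rw [inner_sub_left]
        have := abs_sub (⟪v V j, e⟫) ⟪v W j, e⟫
        linarith [hsmall V hV, hsmall W hW]
      · have h1 := congrFun hVW (⟨i, hi⟩, j)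
        have h2 := Int.abs_sub_lt_one_of_floor_eq_floor h1
        rw [← sub_div, abs_div, abs_of_pos hη, div_lt_one hη] at h2
        rw [inner_sub_right]
        exact h2.le
    have h1 : dist V W ≤ 2 * (k * ((m + 2 * m * (4 + m)) * η)) := by
      refine dist_le_of_norm_sub_projL_le ?_ ?_ (by positivity)
      · intro x hx
        exact norm_sub_projL_le_of_basis (hloc V hV) b (fun j => (hv V j hV).1)
          (fun j => (hv W j hW).1) (fun j => (hv V j hV).2.1) hclose hx
      · intro x hx
        exact norm_sub_projL_le_of_basis (hloc W hW) b (fun j => (hv W j hW).1)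
          (fun j => (hv V j hV).1) (fun j => (hv W j hW).2.1)
          (fun j => by rw [norm_sub_rev]; exact hclose j) hx
    refine (hsep V hV W hW hne).not_ge (h1.trans (le_of_eq ?_))
    rw [sepConst]; ring
  have hmaps : ∀ V ∈ 𝒱, Φ V ∈ Fintype.piFinset
      (fun _ : {i : Fin m // i ≠ i₀} × Fin k => Finset.Icc ⌊-2 / η⌋ ⌊2 / η⌋) := by
    intro V hV
    rw [Fintype.mem_piFinset]
    rintro ⟨i, j⟩
    have h1 : |⟪(c i.1 : EuclideanSpace ℝ (Fin n)), v V j⟫| ≤ 2 := by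
      have := abs_real_inner_le_norm (c i.1 : EuclideanSpace ℝ (Fin n)) (v V j)
      rw [Submodule.norm_coe, c.norm_eq_one, one_mul] at this
      exact this.trans (hv V j hV).2.2
    rw [abs_le] at h1
    rw [Finset.mem_Icc]
    exact ⟨Int.floor_le_floor (by gcongr; exact h1.1), Int.floor_le_floor (by gcongr; exact h1.2)⟩
  have hcard := Finset.card_le_card_of_injOn Φ hmaps hinj
  rw [Fintype.card_piFinset, Finset.prod_const, Finset.card_univ] at hcard
  have hm1 : 1 ≤ m := i₀.pos
  have hidx : Fintype.card ({i : Fin m // i ≠ i₀} × Fin k) = (m - 1) * k := by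
    rw [Fintype.card_prod, Fintype.card_fin, Fintype.card_subtype_compl]
    simp
  rw [hidx] at hcard
  -- There are at most `4 / η + 2` integers here, and `2 ≤ 2 / η`.
  have hIcc : ((Finset.Icc ⌊-2 / η⌋ ⌊2 / η⌋).card : ℝ) ≤ 6 / η := by
    rw [Int.card_Icc]
    have h0 : (0 : ℤ) ≤ ⌊2 / η⌋ + 1 - ⌊-2 / η⌋ := by
      have h1 : (0 : ℤ) ≤ ⌊2 / η⌋ := Int.floor_nonneg.2 (by positivity)
      have h2 : ⌊-2 / η⌋ ≤ 0 := by
        rw [Int.floor_le_iff]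
        have : -2 / η < 0 := div_neg_of_neg_of_pos (by norm_num) hη
        push_cast; linarith
      omega
    have h3 : ((Int.toNat (⌊2 / η⌋ + 1 - ⌊-2 / η⌋) : ℕ) : ℝ)
        = ((⌊2 / η⌋ + 1 - ⌊-2 / η⌋ : ℤ) : ℝ) := by
      exact_mod_cast congrArg (Int.cast : ℤ → ℝ) (Int.toNat_of_nonneg h0)
    rw [h3]
    push_cast
    have h4 := Int.floor_le (2 / η)
    have h5 := Int.lt_floor_add_one (-2 / η)
    have h6 : 2 ≤ 2 / η := by rw [le_div_iff₀ hη]; linarith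
    have h7 : -2 / η = -(2 / η) := neg_div _ _
    have h8 : 6 / η = 3 * (2 / η) := by ring
    rw [h7] at h5 ⊢
    rw [h8]
    linarith
  have hkn : k ≤ n := by omega
  have hexp : ((m - 1) * k : ℕ) = (k : ℝ) * ((n : ℝ) - k) - k := by
    rw [Nat.cast_mul, Nat.cast_sub hm1, hm, Nat.cast_sub hkn]; push_cast; ring
  calc (𝒱.card : ℝ) ≤ ((Finset.Icc ⌊-2 / η⌋ ⌊2 / η⌋).card : ℝ) ^ ((m - 1) * k) := by
        exact_mod_cast hcard
    _ ≤ (6 / η) ^ ((m - 1) * k) := by gcongr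
    _ = 6 ^ ((m - 1) * k) * η ^ (-((k : ℝ) * ((n : ℝ) - k) - k)) := by
        rw [div_pow, ← hexp, Real.rpow_neg hη.le, Real.rpow_natCast, div_eq_mul_inv]
    _ ≤ _ := by
        gcongr
        · norm_num
        · omega

theorem totallyBounded_univ : TotallyBounded (univ : Set (Gr n k)) := by
  have hind : IsUniformInducing (projL : Gr n k → _) := ⟨rfl⟩
  have hb : Bornology.IsBounded (range (projL : Gr n k → _)) := by
    refine (isBounded_closedBall (x := 0) (r := 1)).subset ?_
    rintro _ ⟨V, rfl⟩
    rw [mem_closedBall_zero_iff]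
    exact Submodule.starProjection_norm_le V.1
  have := hb.isCompact_closure.totallyBounded.subset subset_closure
  rw [← preimage_range (projL : Gr n k → _)]
  exact totallyBounded_preimage hind this

theorem isBounded (E : Set (Gr n k)) : Bornology.IsBounded E :=
  totallyBounded_univ.isBounded.subset (subset_univ E)

theorem exists_card_le (n k : ℕ) : ∃ C : ℝ, 0 ≤ C ∧ ∀ η : ℝ, 0 < η → η ≤ 1 / 4 →
    ∀ e : EuclideanSpace ℝ (Fin n), ‖e‖ = 1 → ∀ 𝒱 : Finset (Gr n k),
    (∀ V ∈ 𝒱, ‖projL V e‖ ≤ η) →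
    (∀ V ∈ 𝒱, ∀ W ∈ 𝒱, V ≠ W → sepConst n k * η < dist V W) →
    (𝒱.card : ℝ) ≤ C * η ^ (-((k : ℝ) * ((n : ℝ) - k) - k)) := by
  classical
  obtain ⟨T, -, hT, hcov⟩ := exists_finite_isCover_of_totallyBounded (ε := 1 / 4) (by norm_num)
    (totallyBounded_univ (n := n) (k := k))
  refine ⟨hT.toFinset.card * 6 ^ (n * k), by positivity, fun η hη hη' e he 𝒱 hperp hsep => ?_⟩
  have hsub : 𝒱 ⊆ hT.toFinset.biUnion fun V₀ => 𝒱.filter fun V => dist V V₀ ≤ 1 / 4 := by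
    intro V hV
    obtain ⟨V₀, hV₀, h⟩ := hcov (mem_univ V)
    have h' : edist V V₀ ≤ ((1 / 4 : ℝ≥0) : ℝ≥0∞) := h
    rw [edist_nndist, ENNReal.coe_le_coe] at h'
    have h'' : dist V V₀ ≤ 1 / 4 := by exact_mod_cast h'
    exact Finset.mem_biUnion.2 ⟨V₀, hT.mem_toFinset.2 hV₀, Finset.mem_filter.2 ⟨hV, h''⟩⟩
  have h1 := (Finset.card_le_card hsub).trans Finset.card_biUnion_le
  calc (𝒱.card : ℝ)
      ≤ ∑ V₀ ∈ hT.toFinset, ((𝒱.filter fun V => dist V V₀ ≤ 1 / 4).card : ℝ) := by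
        exact_mod_cast h1
    _ ≤ ∑ _V₀ ∈ hT.toFinset, 6 ^ (n * k) * η ^ (-((k : ℝ) * ((n : ℝ) - k) - k)) := by
        refine Finset.sum_le_sum fun V₀ _ => card_le_of_dist_le V₀ hη hη' he _ ?_ ?_ ?_
        · exact fun V hV => (Finset.mem_filter.1 hV).2
        · exact fun V hV => hperp V (Finset.mem_filter.1 hV).1
        · exact fun V hV W hW => hsep V (Finset.mem_filter.1 hV).1 W (Finset.mem_filter.1 hW).1
    _ = _ := by rw [Finset.sum_const, nsmul_eq_mul, mul_assoc]

end Gr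

/-! ### Double counting of subspaces and pairs of centres. -/

namespace Gr

open Metric Set
open scoped NNReal ENNReal RealInnerProductSpace

variable {n k : ℕ}

theorem coe_proj (V : Gr n k) (x : EuclideanSpace ℝ (Fin n)) :
    (proj V x : EuclideanSpace ℝ (Fin n)) = projL V x := rfl

/-- Over each `y ∈ S`, the centres whose balls meet the fibre in `U₁`, respectively `U₂`, number at
least `L`. They project to within `δ` of `y`, so the `2δ`-separation of `S` makes the pairs for
different `y` distinct. -/
theorem mul_le_card_pairs {A U₁ U₂ : Set (EuclideanSpace ℝ (Fin n))} {δ : ℝ≥0} {ρ L M : ℝ}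
    (hL : 0 ≤ L) (hδρ : 4 * (δ : ℝ) ≤ ρ) (hU : ∀ x ∈ U₁, ∀ x' ∈ U₂, ρ ≤ dist x x')
    {N : Finset (EuclideanSpace ℝ (Fin n))}
    (hN : IsCover δ A (N : Set (EuclideanSpace ℝ (Fin n)))) (V : Gr n k)
    {S : Finset V.1} (hS : IsSeparated ((2 * δ : ℝ≥0) : ℝ≥0∞) (S : Set V.1)) (hM : M ≤ S.card)
    (h₁ : ∀ y ∈ S, ∀ N' : Finset (EuclideanSpace ℝ (Fin n)),
      IsCover δ (A ∩ proj V ⁻¹' {y} ∩ U₁) (N' : Set (EuclideanSpace ℝ (Fin n))) → L ≤ N'.card)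
    (h₂ : ∀ y ∈ S, ∀ N' : Finset (EuclideanSpace ℝ (Fin n)),
      IsCover δ (A ∩ proj V ⁻¹' {y} ∩ U₂) (N' : Set (EuclideanSpace ℝ (Fin n))) → L ≤ N'.card)
    [DecidablePred fun p : EuclideanSpace ℝ (Fin n) × EuclideanSpace ℝ (Fin n) =>
      ρ / 2 ≤ ‖p.1 - p.2‖ ∧ ‖projL V (p.1 - p.2)‖ ≤ 2 * δ] :
    M * (L * L) ≤ ((N ×ˢ N).filter fun p : EuclideanSpace ℝ (Fin n) × EuclideanSpace ℝ (Fin n) =>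
      ρ / 2 ≤ ‖p.1 - p.2‖ ∧ ‖projL V (p.1 - p.2)‖ ≤ 2 * δ).card := by
  classical
  let R : Set (EuclideanSpace ℝ (Fin n)) → V.1 → Finset (EuclideanSpace ℝ (Fin n)) := fun U y =>
    N.filter fun c => ∃ x ∈ A ∩ proj V ⁻¹' {y} ∩ U, dist x c ≤ δ
  have hRcover : ∀ U y, IsCover δ (A ∩ proj V ⁻¹' {y} ∩ U)
      (R U y : Set (EuclideanSpace ℝ (Fin n))) := by
    intro U y x hx
    obtain ⟨c, hc, hxc⟩ := hN hx.1.1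
    have hxc' : edist x c ≤ δ := hxc
    rw [edist_nndist, ENNReal.coe_le_coe] at hxc'
    exact ⟨c, Finset.mem_coe.2 (Finset.mem_filter.2 ⟨hc, x, hx, by exact_mod_cast hxc'⟩), hxc⟩
  have hRproj : ∀ U y c, c ∈ R U y → ‖(y : EuclideanSpace ℝ (Fin n)) - projL V c‖ ≤ δ := by
    intro U y c hc
    obtain ⟨-, x, hx, hxc⟩ := Finset.mem_filter.1 hc
    have hy : proj V x = y := hx.1.2
    rw [← hy, coe_proj, ← map_sub]
    exact (norm_projL_apply_le V _).trans (by rwa [← dist_eq_norm])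
  have hdisj : (S : Set V.1).PairwiseDisjoint fun y => R U₁ y ×ˢ R U₂ y := by
    intro y hy y' hy' hne
    refine Finset.disjoint_left.2 fun p hp hp' => ?_
    have h1 := hRproj _ _ _ (Finset.mem_product.1 hp).1
    have h2 := hRproj _ _ _ (Finset.mem_product.1 hp').1
    have h3 : ((2 * δ : ℝ≥0) : ℝ≥0∞) < edist y y' := hS hy hy' hne
    rw [edist_nndist, ENNReal.coe_lt_coe] at h3
    have h4 : 2 * (δ : ℝ) < dist y y' := by exact_mod_cast h3
    rw [dist_eq_norm, ← Submodule.norm_coe, Submodule.coe_sub] at h4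
    have h5 : (y : EuclideanSpace ℝ (Fin n)) - y'
      = (y - projL V p.1) - (y' - projL V p.1) := by abel
    rw [h5] at h4
    linarith [norm_sub_le ((y : EuclideanSpace ℝ (Fin n)) - projL V p.1) (y' - projL V p.1)]
  have hsub : S.biUnion (fun y => R U₁ y ×ˢ R U₂ y) ⊆
      (N ×ˢ N).filter fun p : EuclideanSpace ℝ (Fin n) × EuclideanSpace ℝ (Fin n) =>
        ρ / 2 ≤ ‖p.1 - p.2‖ ∧ ‖projL V (p.1 - p.2)‖ ≤ 2 * δ := by
    intro p hp
    obtain ⟨y, hy, hp⟩ := Finset.mem_biUnion.1 hp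
    obtain ⟨hp1, hp2⟩ := Finset.mem_product.1 hp
    have hq1 := hRproj _ _ _ hp1
    have hq2 := hRproj _ _ _ hp2
    obtain ⟨hN1, x, hx, hxc⟩ := Finset.mem_filter.1 hp1
    obtain ⟨hN2, x', hx', hxc'⟩ := Finset.mem_filter.1 hp2
    refine Finset.mem_filter.2 ⟨Finset.mem_product.2 ⟨hN1, hN2⟩, ?_, ?_⟩
    · have h1 := hU x hx.2 x' hx'.2
      have h2 := dist_triangle4 x p.1 p.2 x'
      rw [dist_comm p.2 x'] at h2
      rw [← dist_eq_norm]
      linarith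
    · have h5 : projL V (p.1 - p.2) = ((y : EuclideanSpace ℝ (Fin n)) - projL V p.2)
          - (y - projL V p.1) := by rw [map_sub]; abel
      rw [h5]
      linarith [norm_sub_le ((y : EuclideanSpace ℝ (Fin n)) - projL V p.2) (y - projL V p.1)]
  have hcard := Finset.card_le_card hsub
  rw [Finset.card_biUnion hdisj] at hcard
  calc M * (L * L) ≤ S.card * (L * L) := by gcongr
    _ = ∑ _y ∈ S, L * L := by rw [Finset.sum_const, nsmul_eq_mul]
    _ ≤ ∑ y ∈ S, ((R U₁ y ×ˢ R U₂ y).card : ℝ) := by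
        refine Finset.sum_le_sum fun y hy => ?_
        rw [Finset.card_product, Nat.cast_mul]
        exact mul_le_mul (h₁ y hy _ (hRcover U₁ y)) (h₂ y hy _ (hRcover U₂ y)) hL
          (Nat.cast_nonneg _)
    _ ≤ _ := by exact_mod_cast hcard

theorem card_mul_le_of_forall_pairs {E ι : Type*} (N : Finset E) (𝒱 : Finset ι)
    (r : ι → E × E → Prop) [∀ i, DecidablePred (r i)] [∀ p, DecidablePred fun i => r i p]
    {B Q : ℝ} (hB : ∀ i ∈ 𝒱, B ≤ ((N ×ˢ N).filter (r i)).card)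
    (hQ : ∀ p ∈ N ×ˢ N, ((𝒱.filter fun i => r i p).card : ℝ) ≤ Q) :
    𝒱.card * B ≤ (N.card : ℝ) * N.card * Q := by
  have h := Finset.sum_card_bipartiteAbove_eq_sum_card_bipartiteBelow (s := 𝒱) (t := N ×ˢ N) r
  calc 𝒱.card * B = ∑ _i ∈ 𝒱, B := by simp
    _ ≤ ∑ i ∈ 𝒱, (((N ×ˢ N).filter (r i)).card : ℝ) := Finset.sum_le_sum hB
    _ = ∑ p ∈ N ×ˢ N, ((𝒱.filter fun i => r i p).card : ℝ) := by exact_mod_cast h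
    _ ≤ ∑ _p ∈ N ×ˢ N, Q := Finset.sum_le_sum hQ
    _ = _ := by rw [Finset.sum_const, Finset.card_product, nsmul_eq_mul, Nat.cast_mul]

theorem sepConst_nonneg (n k : ℕ) : 0 ≤ sepConst n k := by
  rw [sepConst]; positivity

/-- The set of subspaces `V` for which `δ ^ (-τ)` balls of radius `δ < ρ'` are needed to cover the
set of `y ∈ V` such that the fibre of `A` over `y` has covering numbers at least `δ ^ (-D)` for
`δ < ρ` inside each of `U₁` and `U₂`. -/
def manyRichFibers (n k : ℕ) (A U₁ U₂ : Set (EuclideanSpace ℝ (Fin n))) (ρ ρ' D τ : ℝ) :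
    Set (Gr n k) :=
  {V | ∃ Y : Set V.1,
    (∀ δ : ℝ≥0, 0 < δ → (δ : ℝ) < ρ' → ∀ N : Finset V.1, IsCover δ Y (N : Set V.1) →
      (δ : ℝ) ^ (-τ) ≤ N.card) ∧
    ∀ y ∈ Y, ∀ δ : ℝ≥0, 0 < δ → (δ : ℝ) < ρ → ∀ N : Finset (EuclideanSpace ℝ (Fin n)),
      (IsCover δ (A ∩ proj V ⁻¹' {y} ∩ U₁) (N : Set (EuclideanSpace ℝ (Fin n))) →
        (δ : ℝ) ^ (-D) ≤ N.card) ∧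
      (IsCover δ (A ∩ proj V ⁻¹' {y} ∩ U₂) (N : Set (EuclideanSpace ℝ (Fin n))) →
        (δ : ℝ) ^ (-D) ≤ N.card)}

theorem exists_card_pairs_le (n k : ℕ) : ∃ C : ℝ, 0 ≤ C ∧ ∀ (ρ : ℝ) (δ : ℝ≥0), 0 < ρ → 0 < δ →
    4 * (δ : ℝ) / ρ ≤ 1 / 4 → ∀ z : EuclideanSpace ℝ (Fin n), ∀ 𝒱 : Finset (Gr n k),
    (∀ V ∈ 𝒱, ∀ W ∈ 𝒱, V ≠ W → sepConst n k * (4 * δ / ρ) < dist V W) →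
    (∀ V ∈ 𝒱, ρ / 2 ≤ ‖z‖ ∧ ‖projL V z‖ ≤ 2 * δ) →
    (𝒱.card : ℝ) ≤ C * (4 * δ / ρ) ^ (-((k : ℝ) * ((n : ℝ) - k) - k)) := by
  obtain ⟨C, hC, h⟩ := exists_card_le n k
  refine ⟨C, hC, fun ρ δ hρ hδ hη z 𝒱 hsep hz => ?_⟩
  have hδ' : (0 : ℝ) < δ := by exact_mod_cast hδ
  rcases 𝒱.eq_empty_or_nonempty with rfl | ⟨V₁, hV₁⟩
  · simp; positivity
  have hz1 := (hz V₁ hV₁).1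
  have hz0 : 0 < ‖z‖ := by linarith
  -- After normalising `z`, its projection has norm at most `2δ / (ρ/2) = 4δ / ρ`.
  refine h (4 * δ / ρ) (by positivity) hη (‖z‖⁻¹ • z) ?_ 𝒱 (fun V hV => ?_) hsep
  · rw [norm_smul, norm_inv, norm_norm, inv_mul_cancel₀ hz0.ne']
  · rw [map_smul, norm_smul, norm_inv, norm_norm, ← div_eq_inv_mul, div_le_div_iff₀ hz0 hρ]
    have := (hz V hV).2
    nlinarith

theorem upperBoxDim_manyRichFibers_le {A U₁ U₂ : Set (EuclideanSpace ℝ (Fin n))}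
    {ρ ρ' D τ α : ℝ} (hρ : 0 < ρ) (hρ' : 0 < ρ')
    (hU : ∀ x ∈ U₁, ∀ x' ∈ U₂, ρ ≤ dist x x')
    (hA : ∀ᶠ δ : ℝ≥0 in 𝓝[>] 0, ∃ N : Finset (EuclideanSpace ℝ (Fin n)),
      IsCover δ A (N : Set (EuclideanSpace ℝ (Fin n))) ∧ (N.card : ℝ) ≤ (δ : ℝ) ^ (-α)) :
    upperBoxDim (manyRichFibers n k A U₁ U₂ ρ ρ' D τ) ≤
      ((2 * α + ((k : ℝ) * ((n : ℝ) - k) - k) - τ - 2 * D : ℝ) : EReal) := by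
  classical
  obtain ⟨C, hC, hpairs⟩ := exists_card_pairs_le n k
  set w : ℝ := (k : ℝ) * ((n : ℝ) - k) - k with hw
  set K : ℝ := sepConst n k + 1 with hK
  have hK0 : 0 < K := by have := sepConst_nonneg n k; linarith
  -- With `δ = κ r` one gets `4δ / ρ = r / K`, so an `r`-separated family meets the required
  -- separation `sepConst n k * (4δ / ρ)`. The added `1` in `K` keeps it positive.
  obtain ⟨κ, hκ⟩ : ∃ κ : ℝ≥0, (κ : ℝ) = ρ / (4 * K) := ⟨⟨ρ / (4 * K), by positivity⟩, rfl⟩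
  have hκ0 : (0 : ℝ) < κ := by rw [hκ]; positivity
  have htend : Tendsto (fun r : ℝ≥0 => κ * r) (𝓝[>] 0) (𝓝[>] 0) := by
    refine tendsto_nhdsWithin_iff.2 ⟨?_, ?_⟩
    · have : Tendsto (fun r : ℝ≥0 => κ * r) (𝓝 0) (𝓝 (κ * 0)) := tendsto_id.const_mul κ
      rw [mul_zero] at this
      exact this.mono_left nhdsWithin_le_nhds
    · filter_upwards [self_mem_nhdsWithin] with r hr
      exact mul_pos (by exact_mod_cast hκ0) hr
  have hsmall : ∀ c : ℝ, 0 < c → ∀ᶠ δ : ℝ≥0 in 𝓝[>] 0, (δ : ℝ) < c := fun c hc =>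
    (tendsto_coe_nhdsGT_zero.mono_right nhdsWithin_le_nhds).eventually (gt_mem_nhds hc)
  refine upperBoxDim_le_of_isCover
    (C := C * 2 ^ τ * (κ : ℝ) ^ (τ + 2 * D - 2 * α) * K ^ w) ?_
  filter_upwards [htend.eventually hA, htend.eventually (hsmall (ρ' / 2) (by positivity)),
    htend.eventually (hsmall (ρ / 16) (by positivity)), self_mem_nhdsWithin]
    with r ⟨N, hN, hNcard⟩ hr1 hr2 hr
  set δ : ℝ≥0 := κ * r with hδ
  have hr0 : (0 : ℝ) < r := by exact_mod_cast hr
  have hδr : (δ : ℝ) = κ * r := by rw [hδ]; push_cast; rfl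
  have hδ0 : (0 : ℝ) < δ := by rw [hδr]; positivity
  have hδ0' : 0 < δ := by exact_mod_cast hδ0
  have hη : 4 * (δ : ℝ) / ρ = r / K := by rw [hδr, hκ]; field_simp
  refine exists_isCover_card_le fun 𝒱 h𝒱 hsep => ?_
  have hsep' : ∀ V ∈ 𝒱, ∀ W ∈ 𝒱, V ≠ W → sepConst n k * (4 * δ / ρ) < dist V W := by
    intro V hV W hW hne
    have h1 : (r : ℝ≥0∞) < edist V W := hsep hV hW hne
    rw [edist_nndist, ENNReal.coe_lt_coe] at h1
    have h2 : (r : ℝ) < dist V W := by exact_mod_cast h1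
    refine lt_of_le_of_lt ?_ h2
    rw [hη, ← mul_div_assoc, div_le_iff₀ hK0, mul_comm]
    gcongr
    linarith
  have hcount := card_mul_le_of_forall_pairs N 𝒱
    (fun V p => ρ / 2 ≤ ‖p.1 - p.2‖ ∧ ‖projL V (p.1 - p.2)‖ ≤ 2 * δ)
    (B := (2 * δ : ℝ) ^ (-τ) * ((δ : ℝ) ^ (-D) * (δ : ℝ) ^ (-D)))
    (Q := C * (4 * δ / ρ) ^ (-w)) (fun V hV => by
      obtain ⟨Y, hY, hfib⟩ := h𝒱 hV
      obtain ⟨S, hSY, hS, hScard⟩ := exists_isSeparated_le_card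
        (hY (2 * δ) (by positivity) (by push_cast; linarith))
      rw [NNReal.coe_mul, NNReal.coe_ofNat] at hScard
      exact mul_le_card_pairs (by positivity) (by linarith) hU hN V hS hScard
        (fun y hy N' => (hfib y (hSY hy) δ hδ0' (by linarith) N').1)
        (fun y hy N' => (hfib y (hSY hy) δ hδ0' (by linarith) N').2))
    (fun p _ => hpairs ρ δ hρ hδ0' (by rw [div_le_iff₀ hρ]; linarith) (p.1 - p.2) _
      (fun V hV W hW => hsep' V (Finset.mem_filter.1 hV).1 W (Finset.mem_filter.1 hW).1)
      fun V hV => (Finset.mem_filter.1 hV).2)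
  have hcount' : (𝒱.card : ℝ) * ((2 * δ : ℝ) ^ (-τ) * ((δ : ℝ) ^ (-D) * (δ : ℝ) ^ (-D))) ≤
      (δ : ℝ) ^ (-α) * (δ : ℝ) ^ (-α) * (C * (r / K) ^ (-w)) := by
    rw [hη] at hcount
    refine hcount.trans ?_
    gcongr
  have hB : (0 : ℝ) < (2 * δ : ℝ) ^ (-τ) * ((δ : ℝ) ^ (-D) * (δ : ℝ) ^ (-D)) := by positivity
  refine le_of_mul_le_mul_right (hcount'.trans (le_of_eq ?_)) hB
  rw [Real.mul_rpow (by norm_num) hδ0.le, hδr]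
  simp only [Real.mul_rpow hκ0.le hr0.le, Real.div_rpow hr0.le hK0.le]
  have e1 : -(2 * α + w - τ - 2 * D) = τ + D + D + (-α) + (-α) + (-w) := by ring
  have e2 : τ + 2 * D - 2 * α = τ + D + D + (-α) + (-α) := by ring
  rw [e1, e2]
  simp only [Real.rpow_add hr0, Real.rpow_add hκ0]
  simp only [Real.rpow_neg hr0.le, Real.rpow_neg hκ0.le, Real.rpow_neg hK0.le,
    Real.rpow_neg (zero_le_two (α := ℝ))]
  have p1 := (Real.rpow_pos_of_pos hr0 τ).ne'
  have p2 := (Real.rpow_pos_of_pos hr0 D).ne'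
  have p3 := (Real.rpow_pos_of_pos hκ0 τ).ne'
  have p4 := (Real.rpow_pos_of_pos hκ0 D).ne'
  have p5 := (Real.rpow_pos_of_pos (zero_lt_two (α := ℝ)) τ).ne'
  field_simp

end Gr

/-! ### Countable decompositions and localisation of dimension. -/

section Dimension

open Metric Set
open scoped NNReal ENNReal

theorem hausdorffDim_mono {X : Type*} [EMetricSpace X] {A B : Set X} (h : A ⊆ B) :
    hausdorffDim A ≤ hausdorffDim B := by
  rcases A.eq_empty_or_nonempty with rfl | hA
  · simp [hausdorffDim]
  · rw [hausdorffDim_of_nonempty hA, hausdorffDim_of_nonempty (hA.mono h)]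
    exact_mod_cast dimH_mono h

theorem upperBoxDim_mono {X : Type*} [PseudoEMetricSpace X] {A B : Set X} (h : A ⊆ B) :
    upperBoxDim A ≤ upperBoxDim B := by
  refine iSup₂_mono' fun t ht => ⟨t, ht.trans_le ?_, le_rfl⟩
  refine limsup_le_limsup (Eventually.of_forall fun δ => ?_)
  dsimp only
  gcongr
  exact_mod_cast externalCoveringNumber_mono_set h

theorem packingDim_le_of_subset_iUnion {X : Type*} [PseudoMetricSpace X] {E : Set X} {ι : Type*}
    [Countable ι] [Nonempty ι] {P : ι → Set X} (hE : E ⊆ ⋃ i, P i)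
    (hb : ∀ i, Bornology.IsBounded (P i)) {c : EReal} (hc : ∀ i, upperBoxDim (P i) ≤ c) :
    packingDim E ≤ c := by
  obtain ⟨f, hf⟩ := exists_surjective_nat ι
  refine iInf_le_of_le (fun i => E ∩ P (f i)) (iInf_le_of_le ?_ (iInf_le_of_le ?_ ?_))
  · rw [← inter_iUnion, hf.iUnion_comp P, inter_eq_left.2 hE]
  · exact fun i => (hb (f i)).subset inter_subset_right
  · exact iSup_le fun i => (upperBoxDim_mono inter_subset_right).trans (hc (f i))

theorem exists_lt_hausdorffDim_of_subset_iUnion {X : Type*} [EMetricSpace X] {Y : Set X}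
    {ι : Type*} [Countable ι] {P : ι → Set X} (hY : Y ⊆ ⋃ i, P i) {τ : ℝ}
    (h : (τ : EReal) < hausdorffDim Y) : ∃ i, (τ : EReal) < hausdorffDim (P i) := by
  obtain ⟨y, hy⟩ := nonempty_of_lt_hausdorffDim h
  rcases le_or_gt 0 τ with hτ | hτ
  · lift τ to ℝ≥0 using hτ
    rw [hausdorffDim_of_nonempty ⟨y, hy⟩, ← EReal.coe_nnreal_eq_coe_real,
      EReal.coe_ennreal_lt_coe_ennreal_iff] at h
    have h' := h.trans_le (dimH_mono hY)
    rw [dimH_iUnion, lt_iSup_iff] at h'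
    obtain ⟨i, hi⟩ := h'
    refine ⟨i, ?_⟩
    have hne : (P i).Nonempty := by
      rw [nonempty_iff_ne_empty]
      intro h0
      simp [h0] at hi
    rwa [hausdorffDim_of_nonempty hne, ← EReal.coe_nnreal_eq_coe_real,
      EReal.coe_ennreal_lt_coe_ennreal_iff]
  · obtain ⟨i, hi⟩ := mem_iUnion.1 (hY hy)
    refine ⟨i, ?_⟩
    rw [hausdorffDim_of_nonempty ⟨y, hi⟩]
    exact lt_of_lt_of_le (by exact_mod_cast hτ) (EReal.coe_ennreal_nonneg _)

/-- Some point has full local dimension by countable stability. Removing it leaves a set of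
dimension still above `d`, which supplies the second point. -/
theorem exists_ne_forall_nhds_lt_dimH {X : Type*} [EMetricSpace X] [SecondCountableTopology X]
    {G : Set X} {d : ℝ≥0∞} (h : d < dimH G) :
    ∃ x₁ x₂, x₁ ≠ x₂ ∧ (∀ U ∈ 𝓝 x₁, d < dimH (G ∩ U)) ∧ ∀ U ∈ 𝓝 x₂, d < dimH (G ∩ U) := by
  obtain ⟨x₁, -, h₁⟩ := exists_mem_nhdsWithin_lt_dimH_of_lt_dimH h
  have h' : d < dimH (G \ {x₁}) := by
    have hle : dimH G ≤ max (dimH (G \ {x₁})) 0 := by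
      rw [← dimH_singleton x₁, ← dimH_union]
      exact dimH_mono (by simp)
    rw [max_eq_left (zero_le)] at hle
    exact h.trans_le hle
  obtain ⟨x₂, hx₂, h₂⟩ := exists_mem_nhdsWithin_lt_dimH_of_lt_dimH h'
  refine ⟨x₁, x₂, fun h0 => hx₂.2 h0.symm, fun U hU => h₁ _ ?_, fun U hU => ?_⟩
  · exact inter_mem_nhdsWithin G hU
  · exact (h₂ _ (inter_mem_nhdsWithin _ hU)).trans_le
      (dimH_mono (inter_subset_inter_left _ sdiff_subset))

theorem exists_nat_forall_lt_of_eventually_nhdsGT {p : ℝ≥0 → Prop}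
    (h : ∀ᶠ δ : ℝ≥0 in 𝓝[>] 0, p δ) :
    ∃ m : ℕ, ∀ δ : ℝ≥0, 0 < δ → (δ : ℝ) < 1 / ((m : ℝ) + 1) → p δ := by
  rw [eventually_nhdsWithin_iff, Metric.eventually_nhds_iff] at h
  obtain ⟨ε, hε, h⟩ := h
  obtain ⟨m, hm⟩ := exists_nat_one_div_lt hε
  refine ⟨m, fun δ hδ hlt => h ?_ hδ⟩
  rw [NNReal.dist_eq, NNReal.coe_zero, sub_zero, abs_of_nonneg δ.coe_nonneg]
  exact hlt.trans hm

theorem exists_countableBasis_le_card {X : Type*} [MetricSpace X] [SecondCountableTopology X]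
    {G : Set X} {D : ℝ} (hD : 0 ≤ D) (h : (D : EReal) < hausdorffDim G) :
    ∃ (U₁ U₂ : TopologicalSpace.countableBasis X) (m : ℕ),
      (∀ x ∈ U₁.1, ∀ x' ∈ U₂.1, 1 / ((m : ℝ) + 1) ≤ dist x x') ∧
      ∀ δ : ℝ≥0, 0 < δ → (δ : ℝ) < 1 / ((m : ℝ) + 1) → ∀ N : Finset X,
        (IsCover δ (G ∩ U₁) (N : Set X) → (δ : ℝ) ^ (-D) ≤ N.card) ∧
        (IsCover δ (G ∩ U₂) (N : Set X) → (δ : ℝ) ^ (-D) ≤ N.card) := by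
  have hne := nonempty_of_lt_hausdorffDim h
  lift D to ℝ≥0 using hD
  rw [hausdorffDim_of_nonempty hne, ← EReal.coe_nnreal_eq_coe_real,
    EReal.coe_ennreal_lt_coe_ennreal_iff] at h
  obtain ⟨x₁, x₂, hne, h₁, h₂⟩ := exists_ne_forall_nhds_lt_dimH h
  have hd : 0 < dist x₁ x₂ / 3 := by have := dist_pos.2 hne; positivity
  have hbasis := TopologicalSpace.isBasis_countableBasis X
  obtain ⟨U₁, hU₁, hx₁, hsub₁⟩ := hbasis.mem_nhds_iff.1 (ball_mem_nhds x₁ hd)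
  obtain ⟨U₂, hU₂, hx₂, hsub₂⟩ := hbasis.mem_nhds_iff.1 (ball_mem_nhds x₂ hd)
  have ev := (eventually_le_card_of_lt_dimH (h₁ U₁ ((hbasis.isOpen hU₁).mem_nhds hx₁))).and
    (eventually_le_card_of_lt_dimH (h₂ U₂ ((hbasis.isOpen hU₂).mem_nhds hx₂)))
  obtain ⟨m₁, hm₁⟩ := exists_nat_forall_lt_of_eventually_nhdsGT ev
  obtain ⟨m₂, hm₂⟩ := exists_nat_one_div_lt hd
  have hle₁ : 1 / (((max m₁ m₂ : ℕ) : ℝ) + 1) ≤ 1 / ((m₁ : ℝ) + 1) :=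
    Nat.one_div_le_one_div (le_max_left _ _)
  have hle₂ : 1 / (((max m₁ m₂ : ℕ) : ℝ) + 1) ≤ 1 / ((m₂ : ℝ) + 1) :=
    Nat.one_div_le_one_div (le_max_right _ _)
  refine ⟨⟨U₁, hU₁⟩, ⟨U₂, hU₂⟩, max m₁ m₂, fun x hx x' hx' => ?_, fun δ hδ hlt N => ?_⟩
  · have e1 := mem_ball'.1 (hsub₁ hx)
    have e2 := mem_ball.1 (hsub₂ hx')
    have := dist_triangle4 x₁ x x' x₂
    linarith
  · obtain ⟨e1, e2⟩ := hm₁ δ hδ (hlt.trans_le hle₁)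
    exact ⟨e1 N, e2 N⟩

end Dimension

/-! ### Uniformising the rich fibres of one subspace. -/

namespace Gr

open Metric Set
open scoped NNReal ENNReal

variable {n k : ℕ}

/-- The two basic sets and the scale depend on `y`, but take countably many values; by countable
stability, one choice serves a subset of `Y` of dimension above `τ`. -/
theorem exists_mem_manyRichFibers {A : Set (EuclideanSpace ℝ (Fin n))} {V : Gr n k} {D τ : ℝ}
    (hD : 0 ≤ D) {Y : Set V.1} (hτ : (τ : EReal) < hausdorffDim Y)
    (hY : ∀ y ∈ Y, (D : EReal) < hausdorffDim (A ∩ proj V ⁻¹' {y})) :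
    ∃ (U₁ U₂ : TopologicalSpace.countableBasis (EuclideanSpace ℝ (Fin n))) (m m' : ℕ),
      (∀ x ∈ U₁.1, ∀ x' ∈ U₂.1, 1 / ((m : ℝ) + 1) ≤ dist x x') ∧
      V ∈ manyRichFibers n k A U₁ U₂ (1 / ((m : ℝ) + 1)) (1 / ((m' : ℝ) + 1)) D τ := by
  have : Countable (TopologicalSpace.countableBasis (EuclideanSpace ℝ (Fin n))) :=
    (TopologicalSpace.countable_countableBasis _).to_subtype
  let P : TopologicalSpace.countableBasis (EuclideanSpace ℝ (Fin n)) ×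
      TopologicalSpace.countableBasis (EuclideanSpace ℝ (Fin n)) × ℕ → Set V.1 := fun j =>
    {y | (∀ x ∈ j.1.1, ∀ x' ∈ j.2.1.1, 1 / ((j.2.2 : ℝ) + 1) ≤ dist x x') ∧
      ∀ δ : ℝ≥0, 0 < δ → (δ : ℝ) < 1 / ((j.2.2 : ℝ) + 1) →
        ∀ N : Finset (EuclideanSpace ℝ (Fin n)),
        (IsCover δ (A ∩ proj V ⁻¹' {y} ∩ j.1) (N : Set (EuclideanSpace ℝ (Fin n))) →
          (δ : ℝ) ^ (-D) ≤ N.card) ∧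
        (IsCover δ (A ∩ proj V ⁻¹' {y} ∩ j.2.1) (N : Set (EuclideanSpace ℝ (Fin n))) →
          (δ : ℝ) ^ (-D) ≤ N.card)}
  have hP : Y ⊆ ⋃ j, P j := fun y hy => by
    obtain ⟨U₁, U₂, m, h1, h2⟩ := exists_countableBasis_le_card hD (hY y hy)
    exact mem_iUnion.2 ⟨(U₁, U₂, m), h1, h2⟩
  obtain ⟨⟨U₁, U₂, m⟩, hj⟩ := exists_lt_hausdorffDim_of_subset_iUnion hP hτ
  obtain ⟨m', hm'⟩ := exists_nat_forall_lt_of_eventually_nhdsGT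
    (eventually_le_card_of_lt_hausdorffDim hj)
  obtain ⟨y, hy⟩ := nonempty_of_lt_hausdorffDim hj
  exact ⟨U₁, U₂, m, m', hy.1, P (U₁, U₂, m), hm', fun y hy => hy.2⟩

end Gr

/-! ### Assembling the exceptional set from countably many classes. -/

/-- The rich points lie in `f(A)`, so `a ≤ Δ + s`. Taking `D` in `(Δ - 2ε, Δ - ε)` makes the fibre
bound strict at small cost, and a rational `D` leaves only countably many exponents. -/
theorem AlmostDimConserving.exists_rat_lt {X Y : Type*} [EMetricSpace X] [EMetricSpace Y]
    {f : X → Y} {A : Set X} (hf : AlmostDimConserving f A) {a s ε : ℝ} (hε : 0 < ε)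
    (ha : hausdorffDim A = (a : EReal)) (hs : hausdorffDim (f '' A) ≤ (s : EReal)) :
    ∃ D : ℚ, a - s - 2 * ε ≤ D ∧ ∃ T : Set Y,
      ((a - D - 2 * ε : ℝ) : EReal) < hausdorffDim T ∧
      ∀ y ∈ T, ((D : ℝ) : EReal) < hausdorffDim (A ∩ f ⁻¹' {y}) := by
  obtain ⟨-, Δ, -, hΔ⟩ := hf
  have h := hΔ ε hε
  rw [ha] at h
  have hΔs : a ≤ Δ + s := by
    have h1 := h.trans (add_le_add le_rfl ((hausdorffDim_mono (Set.sep_subset _ _)).trans hs))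
    exact_mod_cast h1
  obtain ⟨D, hD1, hD2⟩ := exists_rat_btwn (show Δ - 2 * ε < Δ - ε by linarith)
  refine ⟨D, by linarith,
    {y ∈ f '' A | ((Δ - ε : ℝ) : EReal) ≤ hausdorffDim (A ∩ f ⁻¹' {y})}, ?_,
    fun y hy => lt_of_lt_of_le ?_ hy.2⟩
  · by_contra! hle
    have h1 := h.trans (add_le_add le_rfl hle)
    have h2 : a ≤ Δ + (a - D - 2 * ε) := by exact_mod_cast h1
    linarith
  · exact_mod_cast hD2

theorem theorem1p5 (n k : ℕ) (hkn : k ≤ n) (A : Set (EuclideanSpace ℝ (Fin n)))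
    (hA : Bornology.IsBounded A) (hdim : hausdorffDim A = upperBoxDim A)
    (F : Set (Gr n k)) (hF : ∀ V : Gr n k, V ∉ F → AlmostDimConserving (Gr.proj V) A)
    (s : ℝ) (hs0 : 0 ≤ s) (hs : (s : EReal) < hausdorffDim A) :
    packingDim {V : Gr n k | hausdorffDim (Gr.proj V '' A) ≤ (s : EReal)} ≤
      max (((k : ℝ) * ((n : ℝ) - (k : ℝ)) - ((k : ℝ) - s) : ℝ) : EReal) (packingDim F) := by
  have hcount : Countable (TopologicalSpace.countableBasis (EuclideanSpace ℝ (Fin n))) :=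
    (TopologicalSpace.countable_countableBasis _).to_subtype
  obtain ⟨a, ha⟩ : ∃ a : ℝ, hausdorffDim A = (a : EReal) := by
    refine ⟨(dimH A).toReal, ?_⟩
    rw [hausdorffDim_of_nonempty (nonempty_of_lt_hausdorffDim hs)]
    exact (EReal.coe_toReal (by simpa using Real.dimH_ne_top A)
      (EReal.coe_ennreal_ne_bot _)).symm.trans (by simp)
  have hsa : s < a := by rw [ha] at hs; exact_mod_cast hs
  refine le_of_forall_gt_imp_ge_of_dense fun c hc => ?_
  obtain ⟨hc1, hc2⟩ := max_lt_iff.1 hc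
  obtain ⟨c', hc'1, hc'2⟩ := EReal.lt_iff_exists_real_btwn.1 hc1
  rw [EReal.coe_lt_coe_iff] at hc'1
  obtain ⟨B, hB⟩ := iInf_lt_iff.1 hc2
  obtain ⟨hFB, hB⟩ := iInf_lt_iff.1 hB
  obtain ⟨hBb, hB⟩ := iInf_lt_iff.1 hB
  obtain ⟨ε, hε, hε1, hε2⟩ : ∃ ε : ℝ, 0 < ε ∧ 2 * ε ≤ a - s ∧
      (k : ℝ) * ((n : ℝ) - k) - (k - s) + 6 * ε ≤ c' := by
    refine ⟨min ((a - s) / 2) ((c' - ((k : ℝ) * ((n : ℝ) - k) - (k - s))) / 6),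
      lt_min (by linarith) (by linarith), ?_, ?_⟩
    · linarith [min_le_left ((a - s) / 2) ((c' - ((k : ℝ) * ((n : ℝ) - k) - (k - s))) / 6)]
    · linarith [min_le_right ((a - s) / 2) ((c' - ((k : ℝ) * ((n : ℝ) - k) - (k - s))) / 6)]
  -- Equality of the two dimensions of `A` enters here: the same `a` governs the fibres and the size
  -- of the nets.
  have hcov := eventually_exists_isCover_of_upperBoxDim_lt (E := A) (u := a + ε) (by linarith)
    (by rw [← hdim, ha]; exact_mod_cast (by linarith : a < a + ε))
  let J := ℚ × TopologicalSpace.countableBasis (EuclideanSpace ℝ (Fin n)) ×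
    TopologicalSpace.countableBasis (EuclideanSpace ℝ (Fin n)) × ℕ × ℕ
  let Q : J → Set (Gr n k) := fun j =>
    {V | (a - s - 2 * ε ≤ j.1 ∧
        ∀ x ∈ j.2.1.1, ∀ x' ∈ j.2.2.1.1, 1 / ((j.2.2.2.1 : ℝ) + 1) ≤ dist x x') ∧
      V ∈ Gr.manyRichFibers n k A j.2.1 j.2.2.1 (1 / ((j.2.2.2.1 : ℝ) + 1))
        (1 / ((j.2.2.2.2 : ℝ) + 1)) j.1 (a - j.1 - 2 * ε)}
  refine packingDim_le_of_subset_iUnion (P := Sum.elim B Q) ?_ (fun i => Gr.isBounded _) ?_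
  · intro V hV
    by_cases hVF : V ∈ F
    · rw [hFB] at hVF
      obtain ⟨i, hi⟩ := Set.mem_iUnion.1 hVF
      exact Set.mem_iUnion.2 ⟨Sum.inl i, hi⟩
    · obtain ⟨D, hD, T, hT, hTD⟩ := (hF V hVF).exists_rat_lt hε ha hV
      obtain ⟨U₁, U₂, m, m', h1, h2⟩ :=
        Gr.exists_mem_manyRichFibers (by linarith) hT hTD
      exact Set.mem_iUnion.2 ⟨Sum.inr (D, U₁, U₂, m, m'), ⟨hD, h1⟩, h2⟩
  · rintro (i | ⟨D, U₁, U₂, m, m'⟩)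
    · exact (le_iSup (fun i => upperBoxDim (B i)) i).trans hB.le
    · refine le_trans ?_ hc'2.le
      -- The conditions on the indices do not involve `V`; if they fail, the class is empty.
      rcases (Q (D, U₁, U₂, m, m')).eq_empty_or_nonempty with h0 | ⟨V, ⟨hD, hU⟩, -⟩
      · change upperBoxDim (Q (D, U₁, U₂, m, m')) ≤ _
        rw [h0]
        refine upperBoxDim_le_of_isCover (C := 0) (Eventually.of_forall fun δ => ⟨∅, by simp⟩)
      · refine (upperBoxDim_mono (B := Gr.manyRichFibers n k A U₁ U₂ (1 / ((m : ℝ) + 1))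
          (1 / ((m' : ℝ) + 1)) D (a - D - 2 * ε)) fun V hV => hV.2).trans
          ((Gr.upperBoxDim_manyRichFibers_le (by positivity) (by positivity) hU hcov).trans ?_)
        rw [EReal.coe_le_coe_iff]
        dsimp only at hD
        -- The exponent equals `k(n-k) - k + a - D + 4ε`, and `D ≥ a - s - 2ε` brings it below
        -- `k(n-k) - (k - s) + 6ε ≤ c'`.
        linarith
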